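/- Let $N\ge 1$ and $\beta\ge 0$. For a bounded domain $\Omega\subset\mathbb R^N$ with piecewise $C^1$ boundary and outward unit normal $n$, call $\lambda\in\mathbb R$ a Robin eigenvalue of $\Omega$ if there is a function $u\colon\overline\Omega\to\mathbb R$, of class $C^2$ in $\Omega$ and $C^1$ on $\overline\Omega$ and not identically zero, with $$\Delta u+\lambda u=0\ \text{ in }\Omega,\qquad \beta\,\frac{\partial u}{\partial n}+u=0\ \text{ on }\partial\Omega$$ (the boundary condition being imposed where the normal exists; $\beta=0$ is the Dirichlet problem), and let $\lambda_1(\Omega)$ be the smallest Robin eigenvalue. For $c>0$ let $\mu(c)$ be the smallest positive solution of $\mu\tan(c\mu)=1/\beta$ if $\beta>0$, and $\mu(c)=\pi/(2c)$ if $\beta=0$. For $\mathbf a=(a_1,\dots,a_N)$ with all $a_j>0$ let $\Omega(\mathbf a)=(-a_1,a_1)\times\dots\times(-a_N,a_N)$. Let $\mathbf a,\mathbf b$ be two vectors with positive entries, and for $0\le t\le 1$ let $\Omega(t)=(1-t)\,\Omega(\mathbf a)+t\,\Omega(\mathbf b)$ be the Minkowski combination. Then, for every $t\in[0,1]$, $\Omega(t)=\Omega((1-t)\mathbf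 a+t\mathbf b)$, and the smallest Robin eigenvalue of $\Omega(t)$ exists, is positive, and is given by $$\lambda_1(\Omega(t))=\sum_{j=1}^N\mu\big((1-t)a_j+t\,b_j\big)^2 .$$ Moreover $t\mapsto\lambda_1(\Omega(t))^{-1/2}$ is a concave function on $[0,1]$; in particular $$\frac1{\sqrt{\lambda_1(\Omega(t))}}\ \ge\ \frac{1-t}{\sqrt{\lambda_1(\Omega(\mathbf a))}}+\frac{t}{\sqrt{\lambda_1(\Omega(\mathbf b))}}\qquad\text{for } 0\le t\le 1 .$$ -/

import Mathlib

open scoped Pointwise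

namespace RobinBox

/-- The open box `(-a₁, a₁) × ⋯ × (-a_N, a_N)` centred at the origin of Euclidean `N`-space. -/
def box {N : ℕ} (a : Fin N → ℝ) : Set (EuclideanSpace ℝ (Fin N)) :=
  {x | ∀ j, -a j < x j ∧ x j < a j}

/-- `ν` is the outward unit normal of the domain `Ω` at its boundary point `x`: close to `x`, and up
to any opening angle, `Ω` is the half-space `⟪y - x, ν⟫ < 0`. Such a `ν` exists exactly at the
points where the boundary is differentiable with `Ω` on one side; at an edge or a corner of a box
there is none. -/
def IsOutwardNormal {N : ℕ} (Ω : Set (EuclideanSpace ℝ (Fin N)))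
    (x ν : EuclideanSpace ℝ (Fin N)) : Prop :=
  x ∈ frontier Ω ∧ ‖ν‖ = 1 ∧
    ∀ ε > 0, ∃ δ > 0, ∀ y : EuclideanSpace ℝ (Fin N), ‖y - x‖ < δ →
      (inner ℝ (y - x) ν < -(ε * ‖y - x‖) → y ∈ Ω) ∧
      (ε * ‖y - x‖ < inner ℝ (y - x) ν → y ∉ Ω)

/-- `u` is a (classical) eigenfunction with eigenvalue `lam` of the problem
`Δu + lam u = 0` in `Ω`, `β ∂u/∂n + u = 0` on `∂Ω`. It is of class `C²` in `Ω` and `C¹` on the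
closure of `Ω`, and it does not vanish identically. The case `β = 0` is the Dirichlet problem.
(Where an outward normal exists, derivatives within the closure of `Ω` are unique.) -/
structure IsRobinEigenfunction {N : ℕ} (β : ℝ) (Ω : Set (EuclideanSpace ℝ (Fin N)))
    (lam : ℝ) (u : EuclideanSpace ℝ (Fin N) → ℝ) : Prop where
  contDiffOn_interior : ContDiffOn ℝ 2 u Ω
  contDiffOn_closure : ContDiffOn ℝ 1 u (closure Ω)
  exists_ne_zero : ∃ x ∈ Ω, u x ≠ 0
  helmholtz : ∀ x ∈ Ω, Laplacian.laplacian u x + lam * u x = 0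
  boundary : ∀ x ν, IsOutwardNormal Ω x ν →
    β * fderivWithin ℝ u (closure Ω) x ν + u x = 0

/-- The set of Robin eigenvalues of `Ω` with parameter `β`. -/
def robinEigenvalues {N : ℕ} (β : ℝ) (Ω : Set (EuclideanSpace ℝ (Fin N))) : Set ℝ :=
  {lam | ∃ u, IsRobinEigenfunction β Ω lam u}

/-- The fundamental (smallest) Robin eigenvalue `λ₁(Ω)`. -/
noncomputable def fundamentalEigenvalue {N : ℕ} (β : ℝ)
    (Ω : Set (EuclideanSpace ℝ (Fin N))) : ℝ :=
  sInf (robinEigenvalues β Ω)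

/-- `μ(β, c)`: the smallest positive solution of `μ tan (c μ) = 1 / β` when `β > 0`, and
`μ(0, c) = π / (2 c)`. -/
noncomputable def mu (β c : ℝ) : ℝ :=
  if β = 0 then Real.pi / (2 * c)
  else sInf {m : ℝ | 0 < m ∧ m * Real.tan (c * m) = 1 / β}

/-- The Minkowski combination `Ω(t) = (1 - t) Ω(a) + t Ω(b)` of two boxes. -/
def boxCombination {N : ℕ} (a b : Fin N → ℝ) (t : ℝ) : Set (EuclideanSpace ℝ (Fin N)) :=
  (1 - t) • box a + t • box b

end RobinBox

/-! On a box the product of the functions cos(μ_j x_j), with μ_j = `mu β (a j)`, satisfies the Robin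
condition on every face, so Σ μ_j² is an eigenvalue. Minimality comes from a maximum principle
(`sum_sq_le_of_isRobinEigenfunction`): for r < 1 the product φ built from r μ_j is positive on the
closed box and a strict supersolution at the boundary. Looking at a maximum of u/φ for an
eigenfunction u that is positive somewhere gives Σ (r μ_j)² ≤ λ, and r → 1 finishes. No variational
theory is used.

Concavity has two ingredients. With s = 1/μ(c), the defining equation becomes c = s · `angle β s`, a
convex and strictly increasing function of s; hence 1/μ is concave in c (`concave_inv_mu`). The map
sending (1/μ_j) to (Σ μ_j²)^(-1/2) is increasing, concave and homogeneous (`power_mean_neg_two`),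
and half-sides are affine in t. -/

namespace RobinBox

/-! ### The transcendental equation for `mu` -/

/-- The value of `mu β c * c`, as a function of `s = 1 / mu β c`. -/
noncomputable def angle (β s : ℝ) : ℝ :=
  if β = 0 then Real.pi / 2 else Real.arctan (s / β)

lemma angle_pos {β s : ℝ} (hβ : 0 ≤ β) (hs : 0 < s) : 0 < angle β s := by
  unfold angle
  split_ifs with h
  · positivity
  · exact Real.arctan_pos.2 (div_pos hs (lt_of_le_of_ne hβ (Ne.symm h)))

lemma angle_le (β s : ℝ) : angle β s ≤ Real.pi / 2 := by
  unfold angle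
  split_ifs
  · exact le_rfl
  · exact (Real.arctan_lt_pi_div_two _).le

lemma angle_mono {β s t : ℝ} (hβ : 0 ≤ β) (hst : s ≤ t) : angle β s ≤ angle β t := by
  unfold angle
  split_ifs
  · exact le_rfl
  · exact Real.arctan_mono (by gcongr)

/-- The tangent equation cleared of denominators, a form that also covers the Dirichlet case. -/
lemma mul_sin_angle {β : ℝ} (s : ℝ) :
    β * Real.sin (angle β s) = s * Real.cos (angle β s) := by
  unfold angle
  split_ifs with h
  · simp [h]
  · have hc := (Real.cos_arctan_pos (s / β)).ne'
    have ht := Real.tan_arctan (s / β)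
    rw [Real.tan_eq_sin_div_cos, div_eq_div_iff hc h] at ht
    linarith

lemma mul_angle_lt {β s t : ℝ} (hβ : 0 ≤ β) (hs : 0 < s) (hst : s < t) :
    s * angle β s < t * angle β t :=
  mul_lt_mul hst (angle_mono hβ hst.le) (angle_pos hβ hs) (hs.trans hst).le

lemma convexOn_mul_arctan : ConvexOn ℝ Set.univ fun x : ℝ => x * Real.arctan x := by
  have h1 : ∀ x : ℝ, HasDerivAt (fun x : ℝ => x * Real.arctan x)
      (Real.arctan x + x * (1 / (1 + x ^ 2))) x := fun x => by
    refine ((hasDerivAt_id' x).fun_mul (Real.hasDerivAt_arctan x)).congr_deriv ?_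
    ring
  have h2 : ∀ x : ℝ, HasDerivAt (fun x : ℝ => Real.arctan x + x * (1 / (1 + x ^ 2)))
      (2 / (1 + x ^ 2) ^ 2) x := fun x => by
    have hx : (1 + x ^ 2) ≠ 0 := by positivity
    have h3 : HasDerivAt (fun x : ℝ => 1 + x ^ 2) (2 * x) x := by
      simpa using (hasDerivAt_pow 2 x).const_add 1
    have := (Real.hasDerivAt_arctan x).fun_add
      ((hasDerivAt_id' x).fun_mul ((hasDerivAt_const x (1 : ℝ)).fun_div h3 hx))
    refine this.congr_deriv ?_
    field_simp
    ring
  refine convexOn_of_hasDerivWithinAt2_nonneg convex_univ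
    (fun x _ => (h1 x).continuousAt.continuousWithinAt)
    (fun x _ => (h1 x).hasDerivWithinAt) (fun x _ => (h2 x).hasDerivWithinAt)
    (fun x _ => by positivity)

lemma convexOn_mul_angle {β : ℝ} (hβ : 0 ≤ β) :
    ConvexOn ℝ Set.univ fun s : ℝ => s * angle β s := by
  rcases eq_or_ne β 0 with rfl | h
  · simp only [angle, if_true]
    exact ((LinearMap.id (R := ℝ) (M := ℝ)).smulRight (Real.pi / 2)).convexOn convex_univ
  · have h1 := (convexOn_mul_arctan.comp_linearMap
      ((LinearMap.id (R := ℝ) (M := ℝ)).smulRight β⁻¹)).smul hβ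
    simp only [Set.preimage_univ] at h1
    refine h1.congr fun s _ => ?_
    simp only [angle, h, if_false, Function.comp, LinearMap.smulRight_apply, LinearMap.id_apply,
      smul_eq_mul, div_eq_mul_inv]
    field_simp

lemma exists_mul_arctan_eq {β c : ℝ} (hβ : 0 < β) (hc : 0 < c) :
    ∃ s, 0 < s ∧ s * Real.arctan (s / β) = c := by
  -- T ≥ β makes the arctangent at least π/4, and T ≥ 4c/π then lifts the product to c.
  set T := max β (4 * c / Real.pi) with hT
  have hT0 : 0 < T := lt_max_of_lt_left hβ
  have hcont : ContinuousOn (fun s : ℝ => s * Real.arctan (s / β)) (Set.Icc 0 T) := by fun_prop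
  have hle : c ≤ T * Real.arctan (T / β) := by
    have h1 : Real.pi / 4 ≤ Real.arctan (T / β) := by
      rw [← Real.arctan_one]
      exact Real.arctan_mono ((one_le_div hβ).2 (le_max_left _ _))
    have h2 : 4 * c / Real.pi ≤ T := le_max_right _ _
    calc c = 4 * c / Real.pi * (Real.pi / 4) := by field_simp
      _ ≤ T * Real.arctan (T / β) := mul_le_mul h2 h1 (by positivity) hT0.le
  obtain ⟨s, hs, hsc⟩ := intermediate_value_Icc hT0.le hcont
    (show c ∈ Set.Icc _ _ from ⟨by simpa using hc.le, hle⟩)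
  refine ⟨s, lt_of_le_of_ne hs.1 ?_, hsc⟩
  rintro rfl
  simp at hsc
  exact hc.ne hsc

/-- For c = s · arctan(s/β), any positive m < 1/s keeps c·m inside (0, π/2), where m · tan(c·m) is
strictly increasing in m. -/
lemma isLeast_mul_tan_eq {β s : ℝ} (hβ : 0 < β) (hs : 0 < s) :
    IsLeast {m : ℝ | 0 < m ∧ m * Real.tan (s * Real.arctan (s / β) * m) = 1 / β} s⁻¹ := by
  have e : s * Real.arctan (s / β) * s⁻¹ = Real.arctan (s / β) := by field_simp
  have hmem : s⁻¹ * Real.tan (s * Real.arctan (s / β) * s⁻¹) = 1 / β := by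
    rw [e, Real.tan_arctan]
    field_simp
  have ha : 0 < Real.arctan (s / β) := Real.arctan_pos.2 (div_pos hs hβ)
  refine ⟨⟨inv_pos.2 hs, hmem⟩, fun m hm => ?_⟩
  by_contra! hlt
  have h0 : 0 < s * Real.arctan (s / β) * m := mul_pos (mul_pos hs ha) hm.1
  have h1 : s * Real.arctan (s / β) * m < s * Real.arctan (s / β) * s⁻¹ := by gcongr
  have h2 : s * Real.arctan (s / β) * s⁻¹ < Real.pi / 2 := e.trans_lt (Real.arctan_lt_pi_div_two _)
  have h3 := Real.tan_lt_tan_of_lt_of_lt_pi_div_two (by linarith [Real.pi_pos]) h2 h1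
  have h4 := Real.tan_pos_of_pos_of_lt_pi_div_two h0 (h1.trans h2)
  have h5 := mul_lt_mul'' hlt h3 hm.1.le h4.le
  rw [hm.2, hmem] at h5
  exact lt_irrefl _ h5

/-- Parametrising by s makes c explicit; the other properties of `mu` are read off from here,
uniformly in β ≥ 0. -/
lemma exists_mu_eq_inv {β c : ℝ} (hβ : 0 ≤ β) (hc : 0 < c) :
    ∃ s, 0 < s ∧ s * angle β s = c ∧ mu β c = s⁻¹ := by
  rcases eq_or_ne β 0 with rfl | h
  · refine ⟨2 * c / Real.pi, by positivity, ?_, ?_⟩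
    · simp only [angle, if_true]
      field_simp
    · simp [mu]
  · have hβ' := lt_of_le_of_ne hβ h.symm
    obtain ⟨s, hs, rfl⟩ := exists_mul_arctan_eq hβ' hc
    exact ⟨s, hs, by simp [angle, h], by
      simpa [mu, h] using (isLeast_mul_tan_eq hβ' hs).csInf_eq⟩

lemma mu_pos {β c : ℝ} (hβ : 0 ≤ β) (hc : 0 < c) : 0 < mu β c := by
  obtain ⟨s, hs, -, h⟩ := exists_mu_eq_inv hβ hc
  exact h ▸ inv_pos.2 hs

lemma mu_mul_le {β c : ℝ} (hβ : 0 ≤ β) (hc : 0 < c) : mu β c * c ≤ Real.pi / 2 := by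
  obtain ⟨s, hs, hc, h⟩ := exists_mu_eq_inv hβ hc
  rw [h, ← hc, inv_mul_cancel_left₀ hs.ne']
  exact angle_le β s

lemma mu_mul_sin {β c : ℝ} (hβ : 0 ≤ β) (hc : 0 < c) :
    β * (mu β c * Real.sin (mu β c * c)) = Real.cos (mu β c * c) := by
  obtain ⟨s, hs, hc, h⟩ := exists_mu_eq_inv hβ hc
  rw [h, ← hc, inv_mul_cancel_left₀ hs.ne', mul_left_comm, mul_sin_angle,
    inv_mul_cancel_left₀ hs.ne']

/-- Equality holds at `mu`; below it the left side does not increase and the cosine strictly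
increases. The strictness is what the comparison argument needs on the boundary. -/
lemma mul_sin_lt_cos_of_lt_mu {β c m : ℝ} (hβ : 0 ≤ β) (hc : 0 < c) (hm : 0 ≤ m)
    (hlt : m < mu β c) : β * (m * Real.sin (m * c)) < Real.cos (m * c) := by
  have h1 : m * c < mu β c * c := by gcongr
  have h2 := mu_mul_le hβ hc
  have h0 : 0 ≤ m * c := by positivity
  have hs : Real.sin (m * c) ≤ Real.sin (mu β c * c) :=
    Real.sin_le_sin_of_le_of_le_pi_div_two (by linarith [Real.pi_pos]) h2 h1.le
  have hs0 : 0 ≤ Real.sin (m * c) :=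
    Real.sin_nonneg_of_nonneg_of_le_pi h0 (by linarith [Real.pi_pos])
  calc β * (m * Real.sin (m * c)) ≤ β * (mu β c * Real.sin (mu β c * c)) :=
        mul_le_mul_of_nonneg_left (mul_le_mul hlt.le hs hs0 (hm.trans hlt.le)) hβ
    _ = Real.cos (mu β c * c) := mu_mul_sin hβ hc
    _ < Real.cos (m * c) :=
        Real.cos_lt_cos_of_nonneg_of_le_pi h0 (by linarith [Real.pi_pos]) h1

/-- The inverse of an increasing convex function is concave. -/
lemma concave_inv_mu {β x y p q : ℝ} (hβ : 0 ≤ β) (hx : 0 < x) (hy : 0 < y) (hp : 0 ≤ p)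
    (hq : 0 ≤ q) (hpq : p + q = 1) :
    p * (mu β x)⁻¹ + q * (mu β y)⁻¹ ≤ (mu β (p * x + q * y))⁻¹ := by
  have hz : 0 < p * x + q * y := by
    simpa using (convex_Ioi (0 : ℝ)) hx hy hp hq hpq
  obtain ⟨s, hs, hsx, h1⟩ := exists_mu_eq_inv hβ hx
  obtain ⟨t, ht, hty, h2⟩ := exists_mu_eq_inv hβ hy
  obtain ⟨r, hr, hrz, h3⟩ := exists_mu_eq_inv hβ hz
  rw [h1, h2, h3, inv_inv, inv_inv, inv_inv]
  by_contra! hlt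
  have h4 := mul_angle_lt hβ hr hlt
  have h5 := (convexOn_mul_angle hβ).2 (Set.mem_univ s) (Set.mem_univ t) hp hq hpq
  simp only [smul_eq_mul] at h5
  rw [hsx, hty] at h5
  linarith

/-! ### Power means -/

/-- Superadditivity of the power mean of exponent `-2`. -/
lemma power_mean_neg_two {ι : Type*} [Fintype ι] [Nonempty ι] {x y z : ι → ℝ} {p q : ℝ}
    (hx : ∀ j, 0 < x j) (hy : ∀ j, 0 < y j) (hp : 0 ≤ p) (hq : 0 ≤ q) (hpq : p + q = 1)
    (hz : ∀ j, p * (x j)⁻¹ + q * (y j)⁻¹ ≤ (z j)⁻¹) (hz0 : ∀ j, 0 < z j) :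
    p / √(∑ j, x j ^ 2) + q / √(∑ j, y j ^ 2) ≤ 1 / √(∑ j, z j ^ 2) := by
  have hX : 0 < ∑ j, x j ^ 2 := Finset.sum_pos (fun j _ => pow_pos (hx j) 2) Finset.univ_nonempty
  have hY : 0 < ∑ j, y j ^ 2 := Finset.sum_pos (fun j _ => pow_pos (hy j) 2) Finset.univ_nonempty
  have hZ : 0 < ∑ j, z j ^ 2 := Finset.sum_pos (fun j _ => pow_pos (hz0 j) 2) Finset.univ_nonempty
  set X := √(∑ j, x j ^ 2) with hXd
  set Y := √(∑ j, y j ^ 2) with hYd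
  have hX0 : 0 < X := Real.sqrt_pos.2 hX
  have hY0 : 0 < Y := Real.sqrt_pos.2 hY
  have hXs : X ^ 2 = ∑ j, x j ^ 2 := Real.sq_sqrt hX.le
  have hYs : Y ^ 2 = ∑ j, y j ^ 2 := Real.sq_sqrt hY.le
  set A := p / X with hA
  set B := q / Y with hB
  have hA0 : 0 ≤ A := by positivity
  have hB0 : 0 ≤ B := by positivity
  have hAB : 0 < A + B := by
    rcases hp.eq_or_lt with rfl | hp
    · have : q = 1 := by linarith
      have : 0 < B := by rw [hB, this]; positivity
      linarith
    · have : 0 < A := by positivity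
      linarith
  -- Convexity of w ↦ w⁻² at X/x_j and Y/y_j, with weights proportional to A and B. The normalised
  -- squares (x_j/X)² and (y_j/Y)² each sum to 1, so summing over j leaves exactly 1 on the right.
  have key : ∀ j, (A + B) ^ 2 * z j ^ 2 ≤
      A / (A + B) * (x j / X) ^ 2 + B / (A + B) * (y j / Y) ^ 2 := fun j => by
    have h1 := (convexOn_zpow (𝕜 := ℝ) (-2)).2 (mul_pos hX0 (inv_pos.2 (hx j)))
      (mul_pos hY0 (inv_pos.2 (hy j))) (div_nonneg hA0 hAB.le) (div_nonneg hB0 hAB.le)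
      (by field_simp)
    simp only [smul_eq_mul] at h1
    have e1 : A / (A + B) * (X * (x j)⁻¹) + B / (A + B) * (Y * (y j)⁻¹) =
        (p * (x j)⁻¹ + q * (y j)⁻¹) / (A + B) := by
      have e3 : A * X = p := by rw [hA]; field_simp
      have e4 : B * Y = q := by rw [hB]; field_simp
      rw [← e3, ← e4]
      ring
    have hpos : 0 < p * (x j)⁻¹ + q * (y j)⁻¹ := by
      simpa using (convex_Ioi (0 : ℝ)) (inv_pos.2 (hx j)) (inv_pos.2 (hy j)) hp hq hpq
    have e2 : ∀ w : ℝ, w ^ (-2 : ℤ) = (w⁻¹) ^ 2 := fun w => by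
      rw [zpow_neg, ← inv_zpow]; rfl
    rw [e1] at h1
    simp only [e2, mul_inv, inv_inv, inv_div] at h1
    have h2 : z j ≤ (p * (x j)⁻¹ + q * (y j)⁻¹)⁻¹ := by
      rw [le_inv_comm₀ (hz0 j) hpos]
      exact hz j
    calc (A + B) ^ 2 * z j ^ 2 = ((A + B) * z j) ^ 2 := by ring
      _ ≤ ((A + B) / (p * (x j)⁻¹ + q * (y j)⁻¹)) ^ 2 := by
          rw [div_eq_mul_inv]
          have := hz0 j
          gcongr
      _ ≤ _ := h1.trans_eq (by rw [div_eq_inv_mul (x j), div_eq_inv_mul (y j)])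
  have hsum : (A + B) ^ 2 * ∑ j, z j ^ 2 ≤ 1 := by
    rw [Finset.mul_sum]
    refine (Finset.sum_le_sum fun j _ => key j).trans_eq ?_
    simp only [Finset.sum_add_distrib, ← Finset.mul_sum, div_pow, ← Finset.sum_div, ← hXs, ← hYs]
    field_simp
  rw [le_div_iff₀ (Real.sqrt_pos.2 hZ)]
  rw [← Real.sqrt_sq hAB.le, ← Real.sqrt_mul (by positivity)]
  exact Real.sqrt_le_one.2 hsum


/-! ### Boxes, their faces and their normals -/

section BoxGeometry

variable {N : ℕ} {a b : Fin N → ℝ}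

lemma box_eq_preimage (a : Fin N → ℝ) :
    box a = PiLp.homeomorph 2 (fun _ : Fin N => ℝ) ⁻¹'
      Set.univ.pi fun j => Set.Ioo (-a j) (a j) := by
  ext x
  simp only [box, Set.mem_ofPred_eq, Set.mem_preimage, Set.mem_univ_pi, Set.mem_Ioo]
  rfl

lemma closure_box_eq_preimage (ha : ∀ j, 0 < a j) :
    closure (box a) = PiLp.homeomorph 2 (fun _ : Fin N => ℝ) ⁻¹'
      Set.univ.pi fun j => Set.Icc (-a j) (a j) := by
  rw [box_eq_preimage, ← Homeomorph.preimage_closure, closure_pi_set]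
  congr! with j
  exact closure_Ioo (by linarith [ha j])

lemma mem_closure_box (ha : ∀ j, 0 < a j) {x : EuclideanSpace ℝ (Fin N)} :
    x ∈ closure (box a) ↔ ∀ j, -a j ≤ x j ∧ x j ≤ a j := by
  rw [closure_box_eq_preimage ha]
  simp only [Set.mem_preimage, Set.mem_univ_pi, Set.mem_Icc]
  rfl

lemma isOpen_box (a : Fin N → ℝ) : IsOpen (box a) := by
  rw [box_eq_preimage]
  exact (isOpen_set_pi Set.finite_univ fun _ _ => isOpen_Ioo).preimage (Homeomorph.continuous _)

lemma isCompact_closure_box (ha : ∀ j, 0 < a j) : IsCompact (closure (box a)) := by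
  rw [closure_box_eq_preimage ha, Homeomorph.isCompact_preimage]
  exact isCompact_univ_pi fun _ => isCompact_Icc

lemma zero_mem_box (ha : ∀ j, 0 < a j) : (0 : EuclideanSpace ℝ (Fin N)) ∈ box a := fun j => by
  simpa using ha j

lemma convex_box (a : Fin N → ℝ) : Convex ℝ (box a) := fun _ hx _ hy _ _ hp hq hpq j =>
  (convex_Ioo (-a j) (a j)) (hx j) (hy j) hp hq hpq

lemma uniqueDiffOn_closure_box (ha : ∀ j, 0 < a j) : UniqueDiffOn ℝ (closure (box a)) :=
  uniqueDiffOn_convex (convex_box a).closure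
    ⟨0, interior_mono subset_closure ((isOpen_box a).interior_eq.symm ▸ zero_mem_box ha)⟩

lemma boxCombination_eq (ha : ∀ j, 0 < a j) (hb : ∀ j, 0 < b j) {t : ℝ}
    (ht : t ∈ Set.Icc (0 : ℝ) 1) :
    boxCombination a b t = box fun j => (1 - t) * a j + t * b j := by
  have hc : ∀ j, 0 < (1 - t) * a j + t * b j := fun j => by
    simpa using (convex_Ioi (0 : ℝ)) (ha j) (hb j) (sub_nonneg.2 ht.2) ht.1 (by ring)
  ext x
  simp only [boxCombination, Set.mem_add, Set.mem_smul_set]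
  constructor
  · rintro ⟨_, ⟨y, hy, rfl⟩, _, ⟨z, hz, rfl⟩, rfl⟩ j
    have h1 := (convex_Ioi (0 : ℝ)) (show 0 < a j - y j by linarith [(hy j).2])
      (show 0 < b j - z j by linarith [(hz j).2]) (sub_nonneg.2 ht.2) ht.1 (by ring)
    have h2 := (convex_Ioi (0 : ℝ)) (show 0 < a j + y j by linarith [(hy j).1])
      (show 0 < b j + z j by linarith [(hz j).1]) (sub_nonneg.2 ht.2) ht.1 (by ring)
    simp only [smul_eq_mul, Set.mem_Ioi] at h1 h2
    simp only [PiLp.add_apply, PiLp.smul_apply, smul_eq_mul]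
    constructor <;> linarith
  · intro hx
    -- The two summands come from rescaling x coordinatewise onto each box.
    have hmem : ∀ d : Fin N → ℝ, (∀ j, 0 < d j) →
        WithLp.toLp 2 (fun j => d j * (x j / ((1 - t) * a j + t * b j))) ∈ box d := by
      intro d hd j
      have h1 : -1 < x j / ((1 - t) * a j + t * b j) := by
        rw [lt_div_iff₀ (hc j)]
        linarith [(hx j).1]
      have h2 : x j / ((1 - t) * a j + t * b j) < 1 := by
        rw [div_lt_iff₀ (hc j)]
        linarith [(hx j).2]
      have := hd j
      constructor <;> simp only <;> nlinarith
    refine ⟨_, ⟨_, hmem a ha, rfl⟩, _, ⟨_, hmem b hb, rfl⟩, ?_⟩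
    ext j
    have := (hc j).ne'
    simp only [PiLp.add_apply, PiLp.smul_apply, smul_eq_mul]
    field_simp

lemma norm_single_sign {σ : ℝ} (hσ : σ = 1 ∨ σ = -1) (j : Fin N) :
    ‖EuclideanSpace.single j σ‖ = 1 := by
  rcases hσ with rfl | rfl <;> simp

/-- A boundary point of the box lies on one of its closed faces. -/
lemma exists_face_of_notMem (ha : ∀ j, 0 < a j) {x : EuclideanSpace ℝ (Fin N)}
    (hx : x ∈ closure (box a)) (hx' : x ∉ box a) :
    ∃ j σ, (σ = 1 ∨ σ = -1) ∧ x j = σ * a j := by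
  rw [mem_closure_box ha] at hx
  simp only [box, Set.mem_ofPred_eq, not_forall, not_and_or, not_lt] at hx'
  obtain ⟨j, h | h⟩ := hx'
  · exact ⟨j, -1, Or.inr rfl, by linarith [(hx j).1]⟩
  · exact ⟨j, 1, Or.inl rfl, by linarith [(hx j).2]⟩

lemma sign_mul_lt {σ : ℝ} (hσ : σ = 1 ∨ σ = -1) {y : EuclideanSpace ℝ (Fin N)}
    (hy : y ∈ box a) (j : Fin N) : σ * y j < a j := by
  rcases hσ with rfl | rfl <;> linarith [(hy j).1, (hy j).2]

/-- The outward normal at a boundary point on a closed face is the normal of that face. -/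
lemma IsOutwardNormal.eq_single {x ν : EuclideanSpace ℝ (Fin N)}
    (h : IsOutwardNormal (box a) x ν) {j : Fin N} {σ : ℝ} (hσ : σ = 1 ∨ σ = -1)
    (hx : x j = σ * a j) : ν = EuclideanSpace.single j σ := by
  set e : EuclideanSpace ℝ (Fin N) := EuclideanSpace.single j σ with he
  have he1 : ‖e‖ = 1 := norm_single_sign hσ j
  by_contra hne
  have hlt : inner ℝ ν e < 1 := (inner_lt_one_iff_real_of_norm_eq_one h.2.1 he1).2 hne
  -- If ν ≠ e, moving along v enters the half-space of ν, since ⟨v, ν⟩ < 0, yet crosses the face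
  -- outwards, since ⟨v, e⟩ > 0. The opening ε below is half of what ⟨v, ν⟩ allows, and the step has
  -- length δ/2.
  set v := e - ν with hv
  have hv0 : 0 < ‖v‖ := norm_pos_iff.2 (sub_ne_zero.2 (Ne.symm hne))
  have hve : 0 < inner ℝ v e := by
    rw [hv, inner_sub_left, real_inner_self_eq_norm_sq, he1]
    linarith
  have hvν : inner ℝ v ν = -inner ℝ v e := by
    rw [hv, inner_sub_left, inner_sub_left, real_inner_self_eq_norm_sq,
      real_inner_self_eq_norm_sq, he1, h.2.1, real_inner_comm]
    ring
  obtain ⟨δ, hδ, H⟩ := h.2.2 (inner ℝ v e / (2 * ‖v‖)) (by positivity)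
  set s := δ / (2 * ‖v‖) with hs
  have hs0 : 0 < s := by positivity
  have hy := (H (x + s • v) (by
    rw [add_sub_cancel_left, norm_smul, Real.norm_of_nonneg hs0.le, hs]
    field_simp
    linarith)).1 (by
    rw [add_sub_cancel_left, norm_smul, Real.norm_of_nonneg hs0.le, inner_smul_left, hvν]
    simp only [conj_trivial]
    have : inner ℝ v e / (2 * ‖v‖) * (s * ‖v‖) = s * inner ℝ v e / 2 := by field_simp
    rw [this]
    nlinarith [mul_pos hs0 hve])
  have h1 := sign_mul_lt hσ hy j
  have h2 : inner ℝ v e = σ * v j := by simp [he, EuclideanSpace.inner_single_right]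
  have h3 : σ * σ = 1 := by rcases hσ with rfl | rfl <;> norm_num
  simp only [PiLp.add_apply, PiLp.smul_apply, smul_eq_mul, hx] at h1
  have h4 : σ * (σ * a j + s * v j) = a j + s * inner ℝ v e := by
    rw [h2]
    linear_combination a j * h3
  linarith [mul_pos hs0 hve]

/-- The points in the relative interior of a face have an outward normal. -/
lemma isOutwardNormal_face (ha : ∀ j, 0 < a j) {x : EuclideanSpace ℝ (Fin N)} {j : Fin N} {σ : ℝ}
    (hσ : σ = 1 ∨ σ = -1) (hx : x j = σ * a j) (hx' : ∀ i ≠ j, -a i < x i ∧ x i < a i) :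
    IsOutwardNormal (box a) x (EuclideanSpace.single j σ) := by
  have h3 : σ * σ = 1 := by rcases hσ with rfl | rfl <;> norm_num
  refine ⟨⟨?_, ?_⟩, norm_single_sign hσ j, fun ε hε => ?_⟩
  · rw [mem_closure_box ha]
    intro i
    rcases eq_or_ne i j with rfl | h
    · rw [hx]
      rcases hσ with rfl | rfl <;> constructor <;> linarith [ha i]
    · exact ⟨(hx' i h).1.le, (hx' i h).2.le⟩
  · rw [(isOpen_box a).interior_eq]
    intro h
    have := sign_mul_lt hσ h j
    rw [hx, ← mul_assoc, h3] at this
    linarith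
  -- Near x only the inequality of this one face can fail, so the box is locally a half-space.
  · have hU : IsOpen {y : EuclideanSpace ℝ (Fin N) |
        (∀ i, i ≠ j → -a i < y i ∧ y i < a i) ∧ -a j < σ * y j} := by
      simp only [Set.ofPred_and, Set.ofPred_forall]
      refine (isOpen_iInter_of_finite fun i => isOpen_iInter_of_finite fun _ =>
        (isOpen_lt (by fun_prop) (by fun_prop)).inter (isOpen_lt (by fun_prop) (by fun_prop))).inter
          (isOpen_lt (by fun_prop) (by fun_prop))
    obtain ⟨δ, hδ, hball⟩ := Metric.isOpen_iff.1 hU x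
      ⟨hx', by rw [hx, ← mul_assoc, h3]; linarith [ha j]⟩
    refine ⟨δ, hδ, fun y hy => ?_⟩
    obtain ⟨hy1, hy2⟩ := hball (mem_ball_iff_norm.2 hy)
    have hin : inner ℝ (y - x) (EuclideanSpace.single j σ) = σ * y j - a j := by
      simp only [EuclideanSpace.inner_single_right, PiLp.sub_apply, hx, conj_trivial, mul_sub,
        ← mul_assoc, h3, one_mul]
    rw [hin]
    have hε' : 0 ≤ ε * ‖y - x‖ := by positivity
    constructor
    · intro h i
      rcases eq_or_ne i j with rfl | h
      · rcases hσ with rfl | rfl <;> constructor <;> linarith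
      · exact hy1 i h
    · intro h hyb
      linarith [sign_mul_lt hσ hyb j]


end BoxGeometry

/-! ### Second derivatives along lines -/

section SecondDerivative

variable {E : Type*} [NormedAddCommGroup E] [NormedSpace ℝ E]

lemma hasDerivAt_line (x v : E) (s : ℝ) : HasDerivAt (fun s : ℝ => x + s • v) v s := by
  simpa using ((hasDerivAt_id s).smul_const v).const_add x

lemma deriv_line_eventuallyEq {f : E → ℝ} {x : E} (hf : ContDiffAt ℝ 2 f x) (v : E) :
    deriv (fun s : ℝ => f (x + s • v)) =ᶠ[nhds 0] fun s => fderiv ℝ f (x + s • v) v := by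
  have h1 : ∀ᶠ y in nhds x, DifferentiableAt ℝ f y :=
    (hf.eventually (by simp)).mono fun y hy => hy.differentiableAt (by norm_num)
  have h2 : Filter.Tendsto (fun s : ℝ => x + s • v) (nhds 0) (nhds x) := by
    simpa using (hasDerivAt_line x v 0).continuousAt.tendsto
  filter_upwards [h2.eventually h1] with s hs
  exact (hs.hasFDerivAt.comp_hasDerivAt s (hasDerivAt_line x v s)).deriv

lemma hasDerivAt_comp_line {f : E → ℝ} {x : E} (hf : DifferentiableAt ℝ f x) (v : E) :
    HasDerivAt (fun s : ℝ => f (x + s • v)) (fderiv ℝ f x v) 0 := by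
  have h : HasFDerivAt f (fderiv ℝ f x) (x + (0 : ℝ) • v) := by simpa using hf.hasFDerivAt
  exact h.comp_hasDerivAt (0 : ℝ) (hasDerivAt_line x v 0)

lemma deriv_deriv_line {f : E → ℝ} {x : E} (hf : ContDiffAt ℝ 2 f x) (v : E) :
    deriv (deriv fun s : ℝ => f (x + s • v)) 0 = fderiv ℝ (fderiv ℝ f) x v v := by
  rw [(deriv_line_eventuallyEq hf v).deriv_eq]
  have h1 : DifferentiableAt ℝ (fderiv ℝ f) x :=
    (hf.fderiv_right (m := 1) (by norm_num)).differentiableAt (by norm_num)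
  have h : HasFDerivAt (fderiv ℝ f) (fderiv ℝ (fderiv ℝ f) x) (x + (0 : ℝ) • v) := by
    simpa using h1.hasFDerivAt
  have h2 : HasDerivAt (fun s : ℝ => fderiv ℝ f (x + s • v)) (fderiv ℝ (fderiv ℝ f) x v) 0 :=
    h.comp_hasDerivAt (0 : ℝ) (hasDerivAt_line x v 0)
  simpa using (h2.clm_apply (hasDerivAt_const (0 : ℝ) v)).deriv

/-- A positive second derivative would make x a local minimum too, hence f locally constant and the
second derivative zero. -/
lemma deriv_deriv_nonpos_of_isLocalMax {f : ℝ → ℝ} {x : ℝ} (hf : ContinuousAt f x)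
    (h : IsLocalMax f x) : deriv (deriv f) x ≤ 0 := by
  by_contra! hpos
  have hmin := isLocalMin_of_deriv_deriv_pos hpos h.deriv_eq_zero hf
  have hc : f =ᶠ[nhds x] fun _ => f x := by
    filter_upwards [h, hmin] with y h1 h2
    exact le_antisymm h1 h2
  have : deriv (deriv f) x = 0 := by
    rw [hc.deriv.deriv_eq]
    simp
  exact hpos.ne' this

lemma fderiv_fderiv_nonpos_of_isLocalMax {f : E → ℝ} {x : E} (hf : ContDiffAt ℝ 2 f x)
    (h : IsLocalMax f x) (v : E) : fderiv ℝ (fderiv ℝ f) x v v ≤ 0 := by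
  rw [← deriv_deriv_line hf v]
  have h0 := (hasDerivAt_comp_line (hf.differentiableAt (by norm_num)) v).continuousAt
  refine deriv_deriv_nonpos_of_isLocalMax h0 ?_
  have h2 : Filter.Tendsto (fun s : ℝ => x + s • v) (nhds 0) (nhds x) := by
    simpa using (hasDerivAt_line x v 0).continuousAt.tendsto
  filter_upwards [h2.eventually h] with s hs
  simpa using hs

end SecondDerivative

/-! ### Products of cosines -/

section SeparatedFunctions

variable {N : ℕ}

lemma laplacian_eq_sum (f : EuclideanSpace ℝ (Fin N) → ℝ) (x : EuclideanSpace ℝ (Fin N)) :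
    Laplacian.laplacian f x = ∑ j, fderiv ℝ (fderiv ℝ f) x (EuclideanSpace.single j (1 : ℝ))
      (EuclideanSpace.single j (1 : ℝ)) := by
  rw [InnerProductSpace.laplacian_eq_iteratedFDeriv_orthonormalBasis f
    (EuclideanSpace.basisFun (Fin N) ℝ)]
  simp [iteratedFDeriv_two_apply]

lemma laplacian_nonpos_of_isLocalMax {f : EuclideanSpace ℝ (Fin N) → ℝ}
    {x : EuclideanSpace ℝ (Fin N)} (hf : ContDiffAt ℝ 2 f x) (h : IsLocalMax f x) :
    Laplacian.laplacian f x ≤ 0 := by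
  rw [laplacian_eq_sum]
  exact Finset.sum_nonpos fun j _ => fderiv_fderiv_nonpos_of_isLocalMax hf h _

/-- The separated function `∏ cos (m_j x_j)`. -/
noncomputable def cosProd (m : Fin N → ℝ) (x : EuclideanSpace ℝ (Fin N)) : ℝ :=
  ∏ j, Real.cos (m j * x j)

lemma contDiff_cosProd (m : Fin N → ℝ) {n : WithTop ℕ∞} : ContDiff ℝ n (cosProd m) := by
  unfold cosProd
  refine contDiff_prod fun j _ => Real.contDiff_cos.comp ?_
  fun_prop

/-- The product of the factors of `cosProd` other than the `j`-th. -/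
noncomputable def cosProdErase (m : Fin N → ℝ) (j : Fin N) (x : EuclideanSpace ℝ (Fin N)) : ℝ :=
  ∏ i ∈ Finset.univ.erase j, Real.cos (m i * x i)

lemma cosProd_eq (m : Fin N → ℝ) (j : Fin N) (x : EuclideanSpace ℝ (Fin N)) :
    cosProd m x = Real.cos (m j * x j) * cosProdErase m j x :=
  (Finset.mul_prod_erase _ _ (Finset.mem_univ j)).symm

lemma cosProd_line (m : Fin N → ℝ) (j : Fin N) (x : EuclideanSpace ℝ (Fin N)) (σ : ℝ) :
    (fun s : ℝ => cosProd m (x + s • EuclideanSpace.single j σ)) =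
      fun s => Real.cos (m j * (x j + s * σ)) * cosProdErase m j x := by
  funext s
  rw [cosProd_eq m j]
  congr 1
  · simp
  · refine Finset.prod_congr rfl fun i hi => ?_
    simp [Finset.ne_of_mem_erase hi]

lemma hasDerivAt_affine (c y σ s : ℝ) : HasDerivAt (fun s : ℝ => c * (y + s * σ)) (c * σ) s := by
  simpa using (((hasDerivAt_id s).mul_const σ).const_add y).const_mul c

lemma fderiv_cosProd (m : Fin N → ℝ) (j : Fin N) (x : EuclideanSpace ℝ (Fin N)) (σ : ℝ) :
    fderiv ℝ (cosProd m) x (EuclideanSpace.single j σ) =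
      -(Real.sin (m j * x j) * (m j * σ)) * cosProdErase m j x := by
  have h1 := hasDerivAt_comp_line ((contDiff_cosProd m (n := 1)).contDiffAt.differentiableAt
    (by norm_num)) (x := x) (EuclideanSpace.single j σ)
  rw [cosProd_line] at h1
  have h2 := ((hasDerivAt_affine (m j) (x j) σ 0).cos).mul_const (cosProdErase m j x)
  rw [h1.unique h2]
  simp

lemma laplacian_cosProd (m : Fin N → ℝ) (x : EuclideanSpace ℝ (Fin N)) :
    Laplacian.laplacian (cosProd m) x = -(∑ j, m j ^ 2) * cosProd m x := by
  rw [laplacian_eq_sum, ← Finset.sum_neg_distrib, Finset.sum_mul]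
  refine Finset.sum_congr rfl fun j _ => ?_
  rw [← deriv_deriv_line (contDiff_cosProd m).contDiffAt, cosProd_line, cosProd_eq m j]
  have h1 : deriv (fun s : ℝ => Real.cos (m j * (x j + s * 1)) * cosProdErase m j x) =
      fun s => -Real.sin (m j * (x j + s * 1)) * (m j * 1) * cosProdErase m j x :=
    funext fun s => (((hasDerivAt_affine (m j) (x j) 1 s).cos).mul_const _).deriv
  rw [h1]
  have h2 := ((((hasDerivAt_affine (m j) (x j) 1 0).sin).fun_neg.mul_const (m j * 1)).mul_const
    (cosProdErase m j x)).deriv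
  rw [h2]
  simp only [add_zero, mul_one]
  ring


end SeparatedFunctions

/-! ### Eigenvalues of a box -/

section RobinEigenvalues

variable {N : ℕ} {a : Fin N → ℝ} {β : ℝ}

lemma IsRobinEigenfunction.neg {Ω : Set (EuclideanSpace ℝ (Fin N))} {lam : ℝ}
    {u : EuclideanSpace ℝ (Fin N) → ℝ} (h : IsRobinEigenfunction β Ω lam u)
    (hΩ : UniqueDiffOn ℝ (closure Ω)) : IsRobinEigenfunction β Ω lam (-u) where
  contDiffOn_interior := h.contDiffOn_interior.neg
  contDiffOn_closure := h.contDiffOn_closure.neg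
  exists_ne_zero := by simpa using h.exists_ne_zero
  helmholtz x hx := by
    rw [InnerProductSpace.laplacian_neg]
    have := h.helmholtz x hx
    simp only [Pi.neg_apply]
    linarith
  boundary x ν hν := by
    have := h.boundary x ν hν
    rw [fderivWithin_neg (hΩ x (frontier_subset_closure hν.1))]
    simp only [Pi.neg_apply, neg_apply]
    linarith

/-- The boundary condition holds on the closed faces of the box, by continuity. -/
lemma IsRobinEigenfunction.boundary_face (ha : ∀ j, 0 < a j) {lam : ℝ}
    {u : EuclideanSpace ℝ (Fin N) → ℝ} (h : IsRobinEigenfunction β (box a) lam u)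
    {x : EuclideanSpace ℝ (Fin N)} (hx : x ∈ closure (box a)) {j : Fin N} {σ : ℝ}
    (hσ : σ = 1 ∨ σ = -1) (hxj : x j = σ * a j) :
    β * fderivWithin ℝ u (closure (box a)) x (EuclideanSpace.single j σ) + u x = 0 := by
  rw [mem_closure_box ha] at hx
  -- The path runs from x to the centre of the face and lies in its relative interior for s > 0,
  -- where the normal exists; the condition passes to s = 0 because u is C¹ up to the boundary.
  set γ : ℝ → EuclideanSpace ℝ (Fin N) := fun s => (1 - s) • x + s • EuclideanSpace.single j (x j)
    with hγ
  have hγj : ∀ s, γ s j = σ * a j := fun s => by simp [hγ, hxj]; ring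
  have hγi : ∀ s, ∀ i ≠ j, γ s i = (1 - s) * x i := fun s i hi => by simp [hγ, hi]
  have hγc : Continuous γ := by fun_prop
  have hmaps : Set.MapsTo γ (Set.Icc 0 1) (closure (box a)) := by
    intro s hs
    rw [mem_closure_box ha]
    intro i
    rcases eq_or_ne i j with rfl | hi
    · rw [hγj, ← hxj]
      exact hx i
    · rw [hγi s i hi]
      have := hx i
      have := ha i
      have := hs.1
      have := hs.2
      constructor <;> nlinarith
  have hcont : ContinuousOn (fun y => β * fderivWithin ℝ u (closure (box a)) y
      (EuclideanSpace.single j σ) + u y) (closure (box a)) :=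
    (continuousOn_const.mul ((h.contDiffOn_closure.continuousOn_fderivWithin
      (uniqueDiffOn_closure_box ha) le_rfl).clm_apply continuousOn_const)).add
      h.contDiffOn_closure.continuousOn
  have heq : Set.EqOn ((fun y => β * fderivWithin ℝ u (closure (box a)) y
      (EuclideanSpace.single j σ) + u y) ∘ γ) (fun _ => 0) (Set.Ioc 0 1) := by
    intro s hs
    refine h.boundary (γ s) _ (isOutwardNormal_face ha hσ (hγj s) fun i hi => ?_)
    rw [hγi s i hi]
    have := hx i
    have := ha i
    have := hs.1
    have := hs.2
    constructor <;> nlinarith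
  have := heq.of_subset_closure (hcont.comp hγc.continuousOn hmaps) continuousOn_const
    Set.Ioc_subset_Icc_self (by rw [closure_Ioc zero_ne_one])
    (Set.left_mem_Icc.2 zero_le_one)
  simpa [hγ] using this

lemma cos_pos_of_mem_closure_box (ha : ∀ j, 0 < a j) {m : Fin N → ℝ} (hm0 : ∀ j, 0 ≤ m j)
    (hm1 : ∀ j, m j * a j < Real.pi / 2) {x : EuclideanSpace ℝ (Fin N)}
    (hx : x ∈ closure (box a)) (j : Fin N) : 0 < Real.cos (m j * x j) := by
  rw [mem_closure_box ha] at hx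
  apply Real.cos_pos_of_mem_Ioo
  have h1 := mul_le_mul_of_nonneg_left (hx j).1 (hm0 j)
  have h2 := mul_le_mul_of_nonneg_left (hx j).2 (hm0 j)
  constructor <;> linarith [hm1 j]

/-- The bracket vanishes for m_j = `mu β (a j)` (eigenfunction) and is positive for smaller m_j ≥ 0
(supersolution). -/
lemma cosProd_normal {m : Fin N → ℝ} {x : EuclideanSpace ℝ (Fin N)} {j : Fin N} {σ : ℝ}
    (hσ : σ = 1 ∨ σ = -1) (hxj : x j = σ * a j) :
    β * fderiv ℝ (cosProd m) x (EuclideanSpace.single j σ) + cosProd m x =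
      (Real.cos (m j * a j) - β * (m j * Real.sin (m j * a j))) * cosProdErase m j x := by
  rw [fderiv_cosProd, cosProd_eq m j, hxj]
  rcases hσ with rfl | rfl
  · simp only [one_mul, mul_one]
    ring
  · simp only [neg_mul, one_mul, mul_neg, mul_one, Real.sin_neg, Real.cos_neg]
    ring

/-- Comparison with a positive strict supersolution of separated form. -/
lemma sum_sq_le_of_isRobinEigenfunction (hβ : 0 ≤ β) (ha : ∀ j, 0 < a j) {m : Fin N → ℝ}
    (hm0 : ∀ j, 0 ≤ m j) (hm1 : ∀ j, m j * a j < Real.pi / 2)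
    (hm2 : ∀ j, β * (m j * Real.sin (m j * a j)) < Real.cos (m j * a j)) {lam : ℝ}
    {u : EuclideanSpace ℝ (Fin N) → ℝ} (h : IsRobinEigenfunction β (box a) lam u)
    (hpos : ∃ x ∈ box a, 0 < u x) : ∑ j, m j ^ 2 ≤ lam := by
  by_contra! hlam
  set K := closure (box a) with hK
  have hφ : ∀ x ∈ K, 0 < cosProd m x := fun x hx =>
    Finset.prod_pos fun j _ => cos_pos_of_mem_closure_box ha hm0 hm1 hx j
  have hφd : ∀ x, DifferentiableAt ℝ (cosProd m) x := fun x =>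
    (contDiff_cosProd m (n := 1)).contDiffAt.differentiableAt (by norm_num)
  have hcont : ContinuousOn (fun x => u x / cosProd m x) K :=
    h.contDiffOn_closure.continuousOn.div (contDiff_cosProd m (n := 0)).continuous.continuousOn
      fun x hx => (hφ x hx).ne'
  obtain ⟨x, hx, hmax⟩ := (isCompact_closure_box ha).exists_isMaxOn
    ⟨0, subset_closure (zero_mem_box ha)⟩ hcont
  set M := u x / cosProd m x with hM
  have hMpos : 0 < M := by
    obtain ⟨y, hy, huy⟩ := hpos
    have hy' : y ∈ K := subset_closure hy
    exact (div_pos huy (hφ y hy')).trans_le (hmax hy')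
  have hux : u x = M * cosProd m x := by
    rw [hM, div_mul_cancel₀ _ (hφ x hx).ne']
  have huxpos : 0 < u x := hux ▸ mul_pos hMpos (hφ x hx)
  -- u − Mφ is at most 0 on the closed box and vanishes at x.
  have hg : IsMaxOn (u - M • cosProd m) K x := by
    intro y hy
    have := hmax hy
    simp only [Set.mem_ofPred_eq, div_le_iff₀ (hφ y hy)] at this
    simp only [Set.mem_ofPred_eq, Pi.sub_apply, Pi.smul_apply, smul_eq_mul]
    linarith
  -- At an interior maximum Δu ≤ MΔφ, that is (Σ m_j²) u(x) ≤ λ u(x), which is impossible as u(x) >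
  -- 0.
  by_cases hxi : x ∈ box a
  · have hnhds := (isOpen_box a).mem_nhds hxi
    have hu2 : ContDiffAt ℝ 2 u x := h.contDiffOn_interior.contDiffAt hnhds
    have hφ2 : ContDiffAt ℝ 2 (cosProd m) x := (contDiff_cosProd m).contDiffAt
    have hψ2 : ContDiffAt ℝ 2 (M • cosProd m) x := hφ2.const_smul M
    have h1 : Laplacian.laplacian (u - M • cosProd m) x ≤ 0 := laplacian_nonpos_of_isLocalMax
      (hu2.sub hψ2) (hg.isLocalMax (Filter.mem_of_superset hnhds subset_closure))
    rw [hu2.laplacian_sub hψ2, InnerProductSpace.laplacian_smul M hφ2,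
      laplacian_cosProd, smul_eq_mul] at h1
    have h2 := h.helmholtz x hxi
    have h3 : M * (-(∑ j, m j ^ 2) * cosProd m x) = -(∑ j, m j ^ 2) * u x := by
      rw [hux]
      ring
    nlinarith
  -- At a boundary maximum, even a corner, one face through x suffices: the derivative of u − Mφ
  -- inwards is at most 0, so its Robin expression is at least 0; but u contributes 0 and φ a
  -- positive amount.
  · obtain ⟨j, σ, hσ, hxj⟩ := exists_face_of_notMem ha hx hxi
    have hu := h.boundary_face ha hx hσ hxj
    have hud : DifferentiableWithinAt ℝ u K x :=
      (h.contDiffOn_closure.differentiableOn (by norm_num)) x hx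
    have huniq := uniqueDiffOn_closure_box ha x hx
    have hseg : segment ℝ x (x + -(a j • EuclideanSpace.single j σ)) ⊆ K := by
      refine (convex_box a).closure.segment_subset hx ?_
      rw [mem_closure_box ha] at hx ⊢
      intro i
      rcases eq_or_ne i j with rfl | hi
      · have h0 : (x + -(a i • EuclideanSpace.single i σ)) i = 0 := by
          simp [hxj, mul_comm]
        rw [h0]
        constructor <;> linarith [ha i]
      · simpa [hi] using hx i
    have h1 := hg.localize.fderivWithin_nonpos (mem_posTangentConeAt_of_segment_subset hseg)
    rw [fderivWithin_sub huniq hud ((hφd x).const_smul M).differentiableWithinAt,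
      fderivWithin_const_smul huniq (hφd x).differentiableWithinAt,
      (hφd x).fderivWithin huniq] at h1
    simp only [map_neg, map_smul, sub_apply, smul_apply, smul_eq_mul, neg_nonpos] at h1
    have h2 := nonneg_of_mul_nonneg_right h1 (ha j)
    have h3 := cosProd_normal (β := β) (m := m) hσ hxj
    have h4 : 0 < cosProdErase m j x :=
      Finset.prod_pos fun i _ => cos_pos_of_mem_closure_box ha hm0 hm1 hx i
    have h5 := mul_pos hMpos (mul_pos (sub_pos.2 (hm2 j)) h4)
    rw [← h3] at h5
    have h6 := mul_nonneg hβ h2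
    rw [hux] at hu
    linarith

lemma sum_mu_sq_le (hβ : 0 ≤ β) (ha : ∀ j, 0 < a j) {lam : ℝ}
    (hlam : lam ∈ robinEigenvalues β (box a)) : ∑ j, mu β (a j) ^ 2 ≤ lam := by
  obtain ⟨u, hu⟩ := hlam
  wlog hpos : ∃ x ∈ box a, 0 < u x generalizing u
  · refine this (-u) (hu.neg (uniqueDiffOn_closure_box ha)) ?_
    push Not at hpos
    obtain ⟨x, hx, hne⟩ := hu.exists_ne_zero
    exact ⟨x, hx, neg_pos.2 (lt_of_le_of_ne (hpos x hx) hne)⟩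
  -- At r = 1 the supersolution is not strict, and for β = 0 it vanishes on the boundary.
  have hr : ∀ r ∈ Set.Ioo (0 : ℝ) 1, ∑ j, (r * mu β (a j)) ^ 2 ≤ lam := by
    intro r hr
    have hlt : ∀ j, r * mu β (a j) < mu β (a j) := fun j =>
      mul_lt_of_lt_one_left (mu_pos hβ (ha j)) hr.2
    have h0 : ∀ j, 0 ≤ r * mu β (a j) := fun j => mul_nonneg hr.1.le (mu_pos hβ (ha j)).le
    exact sum_sq_le_of_isRobinEigenfunction hβ ha h0
      (fun j => (mul_lt_mul_of_pos_right (hlt j) (ha j)).trans_le (mu_mul_le hβ (ha j)))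
      (fun j => mul_sin_lt_cos_of_lt_mu hβ (ha j) (h0 j) (hlt j)) hu hpos
  have hc : Continuous fun r : ℝ => ∑ j, (r * mu β (a j)) ^ 2 := by fun_prop
  have hev : ∀ᶠ r in nhdsWithin (1 : ℝ) (Set.Iio 1), ∑ j, (r * mu β (a j)) ^ 2 ≤ lam := by
    filter_upwards [Ioo_mem_nhdsLT zero_lt_one] with r h using hr r h
  simpa using le_of_tendsto (hc.continuousWithinAt (x := (1 : ℝ))) hev

lemma isRobinEigenfunction_cosProd (hβ : 0 ≤ β) (ha : ∀ j, 0 < a j) :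
    IsRobinEigenfunction β (box a) (∑ j, mu β (a j) ^ 2) (cosProd fun j => mu β (a j)) where
  contDiffOn_interior := (contDiff_cosProd _).contDiffOn
  contDiffOn_closure := (contDiff_cosProd _).contDiffOn
  exists_ne_zero := ⟨0, zero_mem_box ha, by simp [cosProd]⟩
  helmholtz x _ := by
    rw [laplacian_cosProd]
    ring
  boundary x ν hν := by
    have hx : x ∈ closure (box a) := frontier_subset_closure hν.1
    obtain ⟨j, σ, hσ, hxj⟩ := exists_face_of_notMem ha hx
      fun h => hν.1.2 ((isOpen_box a).interior_eq.symm ▸ h)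
    rw [hν.eq_single hσ hxj, ((contDiff_cosProd _ (n := 1)).contDiffAt.differentiableAt
      (by norm_num)).fderivWithin (uniqueDiffOn_closure_box ha x hx), cosProd_normal hσ hxj,
      mu_mul_sin hβ (ha j), sub_self, zero_mul]

lemma isLeast_robinEigenvalues_box (hβ : 0 ≤ β) (ha : ∀ j, 0 < a j) :
    IsLeast (robinEigenvalues β (box a)) (∑ j, mu β (a j) ^ 2) :=
  ⟨⟨_, isRobinEigenfunction_cosProd hβ ha⟩, fun _ => sum_mu_sq_le hβ ha⟩

lemma fundamentalEigenvalue_box (hβ : 0 ≤ β) (ha : ∀ j, 0 < a j) :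
    fundamentalEigenvalue β (box a) = ∑ j, mu β (a j) ^ 2 :=
  (isLeast_robinEigenvalues_box hβ ha).csInf_eq

lemma inv_sqrt_sum_mu_sq_concave [Nonempty (Fin N)] (hβ : 0 ≤ β) {x y : Fin N → ℝ}
    (hx : ∀ j, 0 < x j) (hy : ∀ j, 0 < y j) {p q : ℝ} (hp : 0 ≤ p) (hq : 0 ≤ q)
    (hpq : p + q = 1) :
    p / √(∑ j, mu β (x j) ^ 2) + q / √(∑ j, mu β (y j) ^ 2) ≤
      1 / √(∑ j, mu β (p * x j + q * y j) ^ 2) :=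
  power_mean_neg_two (fun j => mu_pos hβ (hx j)) (fun j => mu_pos hβ (hy j)) hp hq hpq
    (fun j => concave_inv_mu hβ (hx j) (hy j) hp hq hpq)
    fun j => mu_pos hβ (by simpa using (convex_Ioi (0 : ℝ)) (hx j) (hy j) hp hq hpq)

end RobinEigenvalues

end RobinBox

/-! ### The main theorem -/

theorem mainTheorem5 {N : ℕ} (hN : 1 ≤ N) (β : ℝ) (hβ : 0 ≤ β) (a b : Fin N → ℝ)
    (ha : ∀ j, 0 < a j) (hb : ∀ j, 0 < b j) :
    (∀ t ∈ Set.Icc (0 : ℝ) 1,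
      RobinBox.boxCombination a b t = RobinBox.box (fun j => (1 - t) * a j + t * b j) ∧
      IsLeast (RobinBox.robinEigenvalues β (RobinBox.boxCombination a b t))
        (RobinBox.fundamentalEigenvalue β (RobinBox.boxCombination a b t)) ∧
      0 < RobinBox.fundamentalEigenvalue β (RobinBox.boxCombination a b t) ∧
      RobinBox.fundamentalEigenvalue β (RobinBox.boxCombination a b t) =
        ∑ j, RobinBox.mu β ((1 - t) * a j + t * b j) ^ 2) ∧
    ConcaveOn ℝ (Set.Icc (0 : ℝ) 1)
      (fun t => RobinBox.fundamentalEigenvalue β (RobinBox.boxCombination a b t) ^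
        (-(1 / 2) : ℝ)) ∧
    (∀ t ∈ Set.Icc (0 : ℝ) 1,
      (1 - t) / √(RobinBox.fundamentalEigenvalue β (RobinBox.box a)) +
          t / √(RobinBox.fundamentalEigenvalue β (RobinBox.box b)) ≤
        1 / √(RobinBox.fundamentalEigenvalue β (RobinBox.boxCombination a b t))) := by
  have : Nonempty (Fin N) := ⟨⟨0, hN⟩⟩
  have hc : ∀ t ∈ Set.Icc (0 : ℝ) 1, ∀ j, 0 < (1 - t) * a j + t * b j := fun t ht j => by
    simpa using (convex_Ioi (0 : ℝ)) (ha j) (hb j) (sub_nonneg.2 ht.2) ht.1 (by ring)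
  have heig : ∀ t ∈ Set.Icc (0 : ℝ) 1,
      RobinBox.fundamentalEigenvalue β (RobinBox.boxCombination a b t) =
        ∑ j, RobinBox.mu β ((1 - t) * a j + t * b j) ^ 2 := fun t ht => by
    rw [RobinBox.boxCombination_eq ha hb ht, RobinBox.fundamentalEigenvalue_box hβ (hc t ht)]
  refine ⟨fun t ht => ⟨RobinBox.boxCombination_eq ha hb ht, ?_, ?_, heig t ht⟩,
    ⟨convex_Icc 0 1, fun s hs t ht p q hp hq hpq => ?_⟩, fun t ht => ?_⟩
  · rw [heig t ht, RobinBox.boxCombination_eq ha hb ht]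
    exact RobinBox.isLeast_robinEigenvalues_box hβ (hc t ht)
  · rw [heig t ht]
    exact Finset.sum_pos (fun j _ => pow_pos (RobinBox.mu_pos hβ (hc t ht j)) 2)
      Finset.univ_nonempty
  · have hr : ∀ x : ℝ, 0 ≤ x → x ^ (-(1 / 2) : ℝ) = 1 / √x := fun x hx => by
      rw [Real.rpow_neg hx, ← Real.sqrt_eq_rpow, one_div]
    have hmem : p * s + q * t ∈ Set.Icc (0 : ℝ) 1 := (convex_Icc (0 : ℝ) 1) hs ht hp hq hpq
    -- Half-sides are affine in the parameter, so concavity is the two-box inequality applied to the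
    -- boxes at s and t.
    have h := RobinBox.inv_sqrt_sum_mu_sq_concave hβ (hc s hs) (hc t ht) hp hq hpq
    have e : ∀ j, p * ((1 - s) * a j + s * b j) + q * ((1 - t) * a j + t * b j) =
        (1 - (p * s + q * t)) * a j + (p * s + q * t) * b j := fun j => by
      linear_combination a j * hpq
    simp only [e] at h
    simp only [heig s hs, heig t ht, heig _ hmem,
      hr _ (Finset.sum_nonneg fun _ _ => sq_nonneg _), smul_eq_mul, mul_one_div]
    exact h
  · rw [heig t ht, RobinBox.fundamentalEigenvalue_box hβ ha,
      RobinBox.fundamentalEigenvalue_box hβ hb]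
    exact RobinBox.inv_sqrt_sum_mu_sq_concave hβ ha hb (sub_nonneg.2 ht.2) ht.1 (by ring)
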